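/- Let $A,B$ be positive semidefinite complex $n\times n$ matrices, let $0<x<1$, and let $f:[0,\infty)\to[0,\infty)$ be a nonnegative concave function. For a Hermitian matrix $Z$, let $\lambda_1^{\downarrow}(Z)\ge\lambda_2^{\downarrow}(Z)\ge\cdots$ denote its eigenvalues, counted with multiplicity and arranged in nonincreasing order; for positive semidefinite $Z$, let $f(Z)$ be defined by the spectral functional calculus; and let $A\oplus B=\begin{bmatrix}A&0\\0&B\end{bmatrix}$. Then, for $j=0,1,\ldots,n-1$, $$ \lambda_{1+2j}^{\downarrow}\left(f(A\oplus B)\right)\le \lambda_{1+j}^{\downarrow}\left(f(xA+(1-x)B)\right)+\lambda_{1+j}^{\downarrow}\left(f((1-x)A+xB)\right) $$ and $$ \lambda_{1+j}^{\downarrow}\left(f(xA+(1-x)B)+f((1-x)A+xB)\right)\le 2\,\lambda_{1+j}^{\downarrow}\left(f\left(\frac{A+B}{2}\right)\right). $$ -/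

import Mathlib

open scoped ComplexOrder

/-- The functional calculus `f(Z)` of a complex matrix, for a real function `f` (meant for Hermitian
`Z`). This is Mathlib's `cfc`; since the spectrum of a matrix is finite, every `f : ℝ → ℝ` is
continuous on it, so for Hermitian `Z` this is always the genuine spectral calculus. -/
noncomputable def matFun {m : Type*} [Fintype m] [DecidableEq m] (f : ℝ → ℝ) (Z : Matrix m m ℂ) :
    Matrix m m ℂ :=
  cfc f Z

/-- For Hermitian `Z = U diag(λ) U*`, one has `f(Z) = U diag(f(λ)) U*`, for every real function `f`:
no junk value of `cfc` is involved. -/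
theorem matFun_eq {m : Type*} [Fintype m] [DecidableEq m] (f : ℝ → ℝ) {Z : Matrix m m ℂ}
    (hZ : Z.IsHermitian) :
    matFun f Z = (hZ.eigenvectorUnitary : Matrix m m ℂ) *
      Matrix.diagonal (fun i => ((f (hZ.eigenvalues i) : ℝ) : ℂ)) *
      star (hZ.eigenvectorUnitary : Matrix m m ℂ) := by
  unfold matFun
  rw [hZ.cfc_eq f, Matrix.IsHermitian.cfc, Unitary.conjStarAlgAut_apply]
  rfl

/-- `f(Z)` is Hermitian. -/
theorem matFun_isHermitian {m : Type*} [Fintype m] [DecidableEq m] (f : ℝ → ℝ)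
    (Z : Matrix m m ℂ) : (matFun f Z).IsHermitian :=
  cfc_predicate (p := IsSelfAdjoint) f Z

/-- The direct sum `A ⊕ B`, as a block-diagonal matrix. -/
def directSum {n : ℕ} (A B : Matrix (Fin n) (Fin n) ℂ) :
    Matrix (Fin n ⊕ Fin n) (Fin n ⊕ Fin n) ℂ :=
  Matrix.fromBlocks A 0 0 B

/-- `eigDown Z hZ k hk` is the `(1 + k)`-th entry in the list of the eigenvalues of the Hermitian
matrix `Z`, counted with multiplicity and arranged in nonincreasing order
(so `k = 0` gives the largest eigenvalue). -/
noncomputable def eigDown {m : Type*} [Fintype m] [DecidableEq m] (Z : Matrix m m ℂ)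
    (hZ : Z.IsHermitian) (k : ℕ) (hk : k < Fintype.card m) : ℝ :=
  hZ.eigenvalues₀ ⟨k, hk⟩

/-! A nonnegative concave `f` on `[0, ∞)` is nondecreasing and subadditive. Write `P = xA + (1-x)B`
and `Q = (1-x)A + xB`.

First inequality: monotonicity gives `λ_k(f(Z)) = f(λ_k(Z))` (`eigDown_matFun`), so by subadditivity
the case `f = id` suffices (`eigDown_directSum_le`). Rotating `A ⊕ B` by the angle with cosine `√x`
gives diagonal blocks `P` and `Q`. A dimension count yields a unit vector in the span of the top
`2j+1` eigenvectors of `A ⊕ B` whose rotated components `u`, `w` avoid the top `j` eigenvectors of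
`P` and `Q`; the triangle inequality for the seminorm of `A ⊕ B`, then Cauchy–Schwarz, bound its
form.

Second inequality: at a suitable unit vector `v`, Jensen gives `⟨v, f(P)v⟩ ≤ f(⟨v, Pv⟩)`, likewise
for `Q`. Midpoint concavity and min-max then finish, since `P + Q = A + B`. -/

open Matrix

/-! ### Nonnegative concave functions on the half-line -/

section Concave

variable {f : ℝ → ℝ}

/-- Once a concave function descends, it keeps descending at least as fast, and so becomes negative.
-/
theorem ConcaveOn.monotoneOn_Ici_of_nonneg (hf : ConcaveOn ℝ (Set.Ici 0) f)
    (hf0 : ∀ t : ℝ, 0 ≤ t → 0 ≤ f t) : MonotoneOn f (Set.Ici 0) := by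
  intro s hs t ht hst
  by_contra! h
  have hs' : 0 ≤ s := hs
  have hlt : s < t := lt_of_le_of_ne hst (by rintro rfl; exact lt_irrefl _ h)
  have hd : 0 < (f s - f t) / (t - s) := div_pos (by linarith) (by linarith)
  set d := (f s - f t) / (t - s) with hd_def
  have hft : 0 ≤ f t := hf0 t ht
  -- A further distance `(f t + 1) / d` at slope at most `-d` forces a value at most `-1`.
  have hr : 0 < (f t + 1) / d := by positivity
  have hz : 0 ≤ t + (f t + 1) / d := by linarith
  have key := hf.slope_anti_adjacent hs (Set.mem_Ici.2 hz) hlt (by linarith)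
  have hneg : (f t - f s) / (t - s) = -d := by rw [hd_def, ← neg_div, neg_sub]
  rw [hneg, add_sub_cancel_left, div_le_iff₀ hr] at key
  have hdd : d * ((f t + 1) / d) = f t + 1 := by field_simp
  have := hf0 _ hz
  linarith

theorem ConcaveOn.map_add_le_of_nonneg (hf : ConcaveOn ℝ (Set.Ici 0) f)
    (hf0 : ∀ t : ℝ, 0 ≤ t → 0 ≤ f t) {a b : ℝ} (ha : 0 ≤ a) (hb : 0 ≤ b) :
    f (a + b) ≤ f a + f b := by
  have h0 := hf0 0 le_rfl
  rcases (add_nonneg ha hb).eq_or_lt with hab | hab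
  · obtain rfl : a = 0 := by linarith
    obtain rfl : b = 0 := by linarith
    simpa using h0
  · have hz : (0 : ℝ) ∈ Set.Ici (0 : ℝ) := Set.mem_Ici.2 le_rfl
    have hab' : a / (a + b) + b / (a + b) = 1 := by field_simp
    have hpa : 0 ≤ a / (a + b) := by positivity
    have hpb : 0 ≤ b / (a + b) := by positivity
    -- Both `a` and `b` are convex combinations of `a + b` and `0`; the weights on `f (a + b)` add
    -- up to one, and `f 0 ≥ 0` is dropped.
    have h1 := hf.2 (Set.mem_Ici.2 hab.le) hz hpa hpb hab'
    have h2 := hf.2 (Set.mem_Ici.2 hab.le) hz hpb hpa (by linarith)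
    have e1 : a / (a + b) * (a + b) = a := by field_simp
    have e2 : b / (a + b) * (a + b) = b := by field_simp
    simp only [smul_eq_mul, mul_zero, add_zero, e1, e2] at h1 h2
    have e3 : a / (a + b) * f (a + b) + b / (a + b) * f (a + b) = f (a + b) := by
      rw [← add_mul, hab', one_mul]
    linarith [mul_nonneg hpa h0, mul_nonneg hpb h0]

end Concave

/-! ### Quadratic forms -/

section QuadraticForm

variable {m : Type*} [Fintype m]

/-- The real part of the quadratic form `v* Z v`. -/
noncomputable def reQuad (Z : Matrix m m ℂ) (v : m → ℂ) : ℝ :=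
  (star v ⬝ᵥ Z *ᵥ v).re

theorem reQuad_add (Z W : Matrix m m ℂ) (v : m → ℂ) :
    reQuad (Z + W) v = reQuad Z v + reQuad W v := by
  simp [reQuad, add_mulVec, dotProduct_add]

theorem reQuad_smul (c : ℝ) (Z : Matrix m m ℂ) (v : m → ℂ) :
    reQuad (c • Z) v = c * reQuad Z v := by
  simp [reQuad, smul_mulVec, dotProduct_smul]

theorem reQuad_nonneg {Z : Matrix m m ℂ} (hZ : Z.PosSemidef) (v : m → ℂ) : 0 ≤ reQuad Z v :=
  (Complex.le_def.1 (hZ.dotProduct_mulVec_nonneg v)).1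

theorem reQuad_smul_add_smul (Z : Matrix m m ℂ) (a b : ℝ) (u v : m → ℂ) :
    reQuad Z (a • u + b • v) = a ^ 2 * reQuad Z u + b ^ 2 * reQuad Z v +
      a * b * ((star u ⬝ᵥ Z *ᵥ v).re + (star v ⬝ᵥ Z *ᵥ u).re) := by
  simp only [reQuad, star_add, star_smul, star_trivial, mulVec_add, mulVec_smul, add_dotProduct,
    dotProduct_add, smul_dotProduct, dotProduct_smul, Complex.add_re, Complex.smul_re, smul_eq_mul]
  ring

/-- The weighted triangle inequality for the seminorm of a positive semidefinite matrix. -/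
theorem reQuad_smul_add_smul_le {Z : Matrix m m ℂ} (hZ : Z.PosSemidef) (s t a b : ℝ)
    (u v : m → ℂ) :
    a * b * reQuad Z (s • u + t • v) ≤
      (a + b) * (b * (s ^ 2 * reQuad Z u) + a * (t ^ 2 * reQuad Z v)) := by
  -- The gap between the two sides is exactly the form at `b s u - a t v`.
  have h := reQuad_nonneg hZ ((b * s) • u + (-(a * t)) • v)
  rw [reQuad_smul_add_smul] at h ⊢
  nlinarith

theorem reQuad_one_smul_add_smul [DecidableEq m] (a b : ℝ) (u v : m → ℂ) :
    reQuad 1 (a • u + b • v) + reQuad 1 (-b • u + a • v) =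
      (a ^ 2 + b ^ 2) * (reQuad 1 u + reQuad 1 v) := by
  rw [reQuad_smul_add_smul, reQuad_smul_add_smul]
  ring

theorem reQuad_one [DecidableEq m] (v : m → ℂ) : reQuad 1 v = ∑ i, ‖v i‖ ^ 2 := by
  simp only [reQuad, one_mulVec, dotProduct, Complex.re_sum, Pi.star_apply]
  refine Finset.sum_congr rfl fun i _ => ?_
  rw [← Complex.normSq_eq_norm_sq, Complex.normSq_apply]
  simp

/-- Fewer linear conditions than dimensions leave a nonzero solution, which is then normalised.
Every dimension count below rests on this. -/
theorem exists_reQuad_one_eq_one [DecidableEq m] {ι : Type*} [Fintype ι]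
    (φ : ι → (m → ℂ) →ₗ[ℂ] ℂ) (h : Fintype.card ι < Fintype.card m) :
    ∃ v : m → ℂ, reQuad 1 v = 1 ∧ ∀ i, φ i v = 0 := by
  have hker : LinearMap.ker (LinearMap.pi φ) ≠ ⊥ :=
    LinearMap.ker_ne_bot_of_finrank_lt (by simpa using h)
  obtain ⟨v, hv, hv0⟩ := (Submodule.ne_bot_iff _).1 hker
  have hφ : ∀ i, φ i v = 0 := fun i => congrFun (LinearMap.mem_ker.1 hv) i
  obtain ⟨i, hi⟩ := Function.ne_iff.1 hv0
  have hpos : 0 < reQuad 1 v := by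
    rw [reQuad_one]
    refine Finset.sum_pos' (fun _ _ => by positivity) ⟨i, Finset.mem_univ _, ?_⟩
    have : 0 < ‖v i‖ := norm_pos_iff.2 hi
    positivity
  refine ⟨(((√(reQuad 1 v))⁻¹ : ℝ) : ℂ) • v, ?_, fun i => by simp [hφ i]⟩
  have := reQuad_smul_add_smul (1 : Matrix m m ℂ) (√(reQuad 1 v))⁻¹ 0 v 0
  rw [zero_smul, add_zero] at this
  rw [Complex.coe_smul, this, inv_pow, Real.sq_sqrt hpos.le]
  simp [hpos.ne']

end QuadraticForm

/-! ### Eigenvalues, functional calculus and min-max -/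

section Spectral

variable {m : Type*} [Fintype m] [DecidableEq m] {Z : Matrix m m ℂ}

/-- The `i`-th coordinate of a vector in the eigenbasis of a Hermitian matrix whose eigenvalues are
listed in nonincreasing order. -/
noncomputable def eigCoord (hZ : Z.IsHermitian) (i : Fin (Fintype.card m)) : (m → ℂ) →ₗ[ℂ] ℂ :=
  LinearMap.proj ((Fintype.equivOfCardEq (Fintype.card_fin _) : Fin (Fintype.card m) ≃ m) i) ∘ₗ
    mulVecLin (star (hZ.eigenvectorUnitary : Matrix m m ℂ))

theorem reQuad_matFun (hZ : Z.IsHermitian) (f : ℝ → ℝ) (v : m → ℂ) :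
    reQuad (matFun f Z) v = ∑ i, ‖eigCoord hZ i v‖ ^ 2 * f (hZ.eigenvalues₀ i) := by
  set U := (hZ.eigenvectorUnitary : Matrix m m ℂ) with hU
  have h : reQuad (matFun f Z) v =
      ∑ i, ‖(star U *ᵥ v) i‖ ^ 2 * f (hZ.eigenvalues i) := by
    have hs : star (star U *ᵥ v) = star v ᵥ* U := by
      rw [star_mulVec, star_eq_conjTranspose, conjTranspose_conjTranspose]
    rw [reQuad, matFun_eq f hZ, ← hU, ← mulVec_mulVec, ← mulVec_mulVec, dotProduct_mulVec, ← hs]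
    simp only [dotProduct, mulVec_diagonal, Complex.re_sum]
    refine Finset.sum_congr rfl fun i _ => ?_
    rw [← Complex.normSq_eq_norm_sq, Complex.normSq_apply]
    simp
    ring
  rw [h, ← (Fintype.equivOfCardEq (Fintype.card_fin _) : Fin (Fintype.card m) ≃ m).sum_comp]
  simp [eigCoord, Matrix.IsHermitian.eigenvalues, hU]

theorem matFun_id (hZ : Z.IsHermitian) : matFun id Z = Z :=
  cfc_id ℝ Z (ha := hZ)

theorem reQuad_one_eq_sum (hZ : Z.IsHermitian) (v : m → ℂ) :
    reQuad 1 v = ∑ i, ‖eigCoord hZ i v‖ ^ 2 := by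
  have h : matFun (fun _ => 1) Z = 1 := cfc_const_one ℝ Z (ha := hZ)
  rw [← h, reQuad_matFun hZ]
  simp

theorem reQuad_eq_sum (hZ : Z.IsHermitian) (v : m → ℂ) :
    reQuad Z v = ∑ i, ‖eigCoord hZ i v‖ ^ 2 * hZ.eigenvalues₀ i := by
  have h := reQuad_matFun hZ id v
  rwa [matFun_id hZ] at h

theorem reQuad_matFun_le (hZ : Z.IsHermitian) {f : ℝ → ℝ} {v : m → ℂ} {c : ℝ}
    (h : ∀ i, eigCoord hZ i v ≠ 0 → f (hZ.eigenvalues₀ i) ≤ c) :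
    reQuad (matFun f Z) v ≤ c * reQuad 1 v := by
  rw [reQuad_matFun hZ, reQuad_one_eq_sum hZ, Finset.mul_sum]
  refine Finset.sum_le_sum fun i _ => ?_
  by_cases hi : eigCoord hZ i v = 0
  · simp [hi]
  · rw [mul_comm]
    exact mul_le_mul_of_nonneg_right (h i hi) (by positivity)

theorem le_reQuad_matFun (hZ : Z.IsHermitian) {f : ℝ → ℝ} {v : m → ℂ} {c : ℝ}
    (h : ∀ i, eigCoord hZ i v ≠ 0 → c ≤ f (hZ.eigenvalues₀ i)) :
    c * reQuad 1 v ≤ reQuad (matFun f Z) v := by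
  rw [reQuad_matFun hZ, reQuad_one_eq_sum hZ, Finset.mul_sum]
  refine Finset.sum_le_sum fun i _ => ?_
  by_cases hi : eigCoord hZ i v = 0
  · simp [hi]
  · rw [mul_comm c]
    exact mul_le_mul_of_nonneg_left (h i hi) (by positivity)

/-- One half of Courant–Fischer: on the span of the top `k + 1` eigenvectors the form averages
eigenvalues no smaller than the `k`-th, counting from zero. -/
theorem eigDown_mul_le_reQuad (hZ : Z.IsHermitian) {k : ℕ} (hk : k < Fintype.card m)
    {v : m → ℂ} (h : ∀ i : Fin (Fintype.card m), k < i → eigCoord hZ i v = 0) :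
    eigDown Z hZ k hk * reQuad 1 v ≤ reQuad Z v := by
  have := le_reQuad_matFun hZ (f := id) (v := v) (c := eigDown Z hZ k hk) fun i hi =>
    hZ.eigenvalues₀_antitone (Fin.le_def.2 (not_lt.1 (mt (h i) hi)))
  rwa [matFun_id hZ] at this

theorem reQuad_le_eigDown_mul (hZ : Z.IsHermitian) {k : ℕ} (hk : k < Fintype.card m)
    {v : m → ℂ} (h : ∀ i : Fin (Fintype.card m), (i : ℕ) < k → eigCoord hZ i v = 0) :
    reQuad Z v ≤ eigDown Z hZ k hk * reQuad 1 v := by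
  have := reQuad_matFun_le hZ (f := id) (v := v) (c := eigDown Z hZ k hk) fun i hi =>
    hZ.eigenvalues₀_antitone (Fin.le_def.2 (not_lt.1 (mt (h i) hi)))
  rwa [matFun_id hZ] at this

theorem eigenvalues₀_nonneg (hZ : Z.PosSemidef) (i : Fin (Fintype.card m)) :
    0 ≤ hZ.isHermitian.eigenvalues₀ i := by
  have := hZ.eigenvalues_nonneg
    ((Fintype.equivOfCardEq (Fintype.card_fin _) : Fin (Fintype.card m) ≃ m) i)
  simpa [Matrix.IsHermitian.eigenvalues] using this

theorem Fin.card_subtype_val_lt {N k : ℕ} (hk : k < N) :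
    Fintype.card {i : Fin N // (i : ℕ) < k} = k := by
  rw [Fintype.card_subtype]
  convert Fin.card_Iio (⟨k, hk⟩ : Fin N) using 2
  ext i
  simp [Fin.lt_def]

theorem Fin.card_subtype_lt_val {N k : ℕ} (hk : k < N) :
    Fintype.card {i : Fin N // k < (i : ℕ)} = N - 1 - k := by
  rw [Fintype.card_subtype]
  convert Fin.card_Ioi (⟨k, hk⟩ : Fin N) using 2
  ext i
  simp [Fin.lt_def]

/-- The span of the top `k + 1` eigenvectors of `Z` meets the span of the bottom `N - k`
eigenvectors of `W` in a unit vector. -/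
theorem exists_unit_eigCoord_eq_zero {W : Matrix m m ℂ} (hZ : Z.IsHermitian) (hW : W.IsHermitian)
    {k : ℕ} (hk : k < Fintype.card m) :
    ∃ v : m → ℂ, reQuad 1 v = 1 ∧
      (∀ i : Fin (Fintype.card m), k < i → eigCoord hZ i v = 0) ∧
      ∀ i : Fin (Fintype.card m), (i : ℕ) < k → eigCoord hW i v = 0 := by
  obtain ⟨v, hv, h⟩ := exists_reQuad_one_eq_one
    (ι := {i : Fin (Fintype.card m) // k < (i : ℕ)} ⊕ {i : Fin (Fintype.card m) // (i : ℕ) < k})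
    (Sum.elim (fun i => eigCoord hZ i) (fun i => eigCoord hW i))
    -- With `N` the dimension, there are `(N - 1 - k) + k = N - 1` conditions.
    (by rw [Fintype.card_sum, Fin.card_subtype_val_lt hk, Fin.card_subtype_lt_val hk]; omega)
  exact ⟨v, hv, fun i hi => h (Sum.inl ⟨i, hi⟩), fun i hi => h (Sum.inr ⟨i, hi⟩)⟩

/-- Each inequality tests the form of `f(Z)` on a unit vector common to a top eigenspace of one of
`Z`, `f(Z)` and a bottom one of the other. This avoids matching two sorted eigenvalue lists. -/
theorem eigDown_matFun (hZ : Z.PosSemidef) {f : ℝ → ℝ} (hf : MonotoneOn f (Set.Ici 0))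
    {k : ℕ} (hk : k < Fintype.card m) :
    eigDown (matFun f Z) (matFun_isHermitian f Z) k hk = f (eigDown Z hZ.isHermitian k hk) := by
  have hH := hZ.isHermitian
  have hmono {i j : Fin (Fintype.card m)} (hij : i ≤ j) :
      f (hH.eigenvalues₀ j) ≤ f (hH.eigenvalues₀ i) :=
    hf (eigenvalues₀_nonneg hZ j) (eigenvalues₀_nonneg hZ i) (hH.eigenvalues₀_antitone hij)
  apply le_antisymm
  · obtain ⟨v, hv, h1, h2⟩ := exists_unit_eigCoord_eq_zero (matFun_isHermitian f Z) hH hk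
    have ha := eigDown_mul_le_reQuad _ hk h1
    have hb := reQuad_matFun_le hH (f := f) (v := v) (c := f (eigDown Z hH k hk)) fun i hi =>
      hmono (Fin.le_def.2 (not_lt.1 (mt (h2 i) hi)))
    rw [hv, mul_one] at ha hb
    exact ha.trans hb
  · obtain ⟨v, hv, h1, h2⟩ := exists_unit_eigCoord_eq_zero hH (matFun_isHermitian f Z) hk
    have ha := reQuad_le_eigDown_mul _ hk h2
    have hb := le_reQuad_matFun hH (f := f) (v := v) (c := f (eigDown Z hH k hk)) fun i hi =>
      hmono (Fin.le_def.2 (not_lt.1 (mt (h1 i) hi)))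
    rw [hv, mul_one] at ha hb
    exact hb.trans ha

/-- Jensen's inequality: the squared moduli of the eigenbasis coordinates of a unit vector are
weights of sum one. -/
theorem reQuad_matFun_le_map_reQuad (hZ : Z.PosSemidef) {f : ℝ → ℝ}
    (hf : ConcaveOn ℝ (Set.Ici 0) f) {v : m → ℂ} (hv : reQuad 1 v = 1) :
    reQuad (matFun f Z) v ≤ f (reQuad Z v) := by
  rw [reQuad_matFun hZ.isHermitian, reQuad_eq_sum hZ.isHermitian]
  exact hf.le_map_sum (fun i _ => by positivity)
    ((reQuad_one_eq_sum hZ.isHermitian v).symm.trans hv) fun i _ => eigenvalues₀_nonneg hZ i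

theorem eigDown_matFun_add_matFun_le {P Q : Matrix m m ℂ} (hP : P.PosSemidef)
    (hQ : Q.PosSemidef) {f : ℝ → ℝ} (hf : ConcaveOn ℝ (Set.Ici 0) f)
    (hmono : MonotoneOn f (Set.Ici 0)) {k : ℕ} (hk : k < Fintype.card m) :
    eigDown (matFun f P + matFun f Q) ((matFun_isHermitian f P).add (matFun_isHermitian f Q)) k hk ≤
      2 * eigDown (matFun f ((1 / 2 : ℝ) • (P + Q))) (matFun_isHermitian f _) k hk := by
  have hR : ((1 / 2 : ℝ) • (P + Q)).PosSemidef := (hP.add hQ).smul (by norm_num)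
  rw [eigDown_matFun hR hmono]
  obtain ⟨v, hv, h1, h2⟩ := exists_unit_eigCoord_eq_zero
    ((matFun_isHermitian f P).add (matFun_isHermitian f Q)) hR.isHermitian hk
  have ha := eigDown_mul_le_reQuad _ hk h1
  have hb := reQuad_le_eigDown_mul _ hk h2
  rw [hv, mul_one] at ha hb
  rw [reQuad_add] at ha
  have hjP := reQuad_matFun_le_map_reQuad hP hf hv
  have hjQ := reQuad_matFun_le_map_reQuad hQ hf hv
  have hmid := hf.2 (Set.mem_Ici.2 (reQuad_nonneg hP v)) (Set.mem_Ici.2 (reQuad_nonneg hQ v))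
    (show (0 : ℝ) ≤ 1 / 2 by norm_num) (show (0 : ℝ) ≤ 1 / 2 by norm_num) (by norm_num)
  have hRv : reQuad ((1 / 2 : ℝ) • (P + Q)) v = 1 / 2 * reQuad P v + 1 / 2 * reQuad Q v := by
    rw [reQuad_smul, reQuad_add, mul_add]
  simp only [smul_eq_mul, ← hRv] at hmid
  have hlast := hmono (Set.mem_Ici.2 (reQuad_nonneg hR v))
    (Set.mem_Ici.2 (eigenvalues₀_nonneg hR ⟨k, hk⟩)) hb
  change f (reQuad ((1 / 2 : ℝ) • (P + Q)) v) ≤ f (eigDown _ hR.isHermitian k hk) at hlast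
  linarith

end Spectral

/-! ### The direct sum and its rotation -/

section DirectSum

variable {n : ℕ} {A B : Matrix (Fin n) (Fin n) ℂ}

theorem reQuad_directSum (A B : Matrix (Fin n) (Fin n) ℂ) (z : Fin n ⊕ Fin n → ℂ) :
    reQuad (directSum A B) z = reQuad A (z ∘ Sum.inl) + reQuad B (z ∘ Sum.inr) := by
  simp [reQuad, directSum, fromBlocks_mulVec, dotProduct]

theorem reQuad_one_sum (z : Fin n ⊕ Fin n → ℂ) :
    reQuad 1 z = reQuad 1 (z ∘ Sum.inl) + reQuad 1 (z ∘ Sum.inr) := by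
  simp [reQuad_one]

theorem posSemidef_directSum (hA : A.PosSemidef) (hB : B.PosSemidef) :
    (directSum A B).PosSemidef := by
  refine .of_dotProduct_mulVec_nonneg ?_ fun z => ?_
  · exact IsHermitian.fromBlocks hA.isHermitian (by simp) hB.isHermitian
  · have := add_nonneg (hA.dotProduct_mulVec_nonneg (z ∘ Sum.inl))
      (hB.dotProduct_mulVec_nonneg (z ∘ Sum.inr))
    simpa [directSum, fromBlocks_mulVec, dotProduct] using this

/-- The form of `A ⊕ B` at a vector, bounded through the diagonal blocks of its conjugate by the
rotation with entries `c`, `s`. -/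
theorem mul_reQuad_directSum_le (hA : A.PosSemidef) (hB : B.PosSemidef) (c s a b : ℝ)
    (u w : Fin n → ℂ) :
    a * b * reQuad (directSum A B) (Sum.elim (c • u + -s • w) (s • u + c • w)) ≤
      (a + b) * (b * reQuad (c ^ 2 • A + s ^ 2 • B) u + a * reQuad (s ^ 2 • A + c ^ 2 • B) w) := by
  rw [reQuad_directSum, Sum.elim_comp_inl, Sum.elim_comp_inr]
  have h1 := reQuad_smul_add_smul_le hA c (-s) a b u w
  have h2 := reQuad_smul_add_smul_le hB s c a b u w
  simp only [reQuad_add, reQuad_smul]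
  nlinarith

theorem eigDown_directSum_le (hA : A.PosSemidef) (hB : B.PosSemidef) {x : ℝ} (hx0 : 0 ≤ x)
    (hx1 : x ≤ 1) {j : ℕ} (hj : j < Fintype.card (Fin n))
    (hj2 : 2 * j < Fintype.card (Fin n ⊕ Fin n))
    (hP : (x • A + (1 - x) • B).PosSemidef) (hQ : ((1 - x) • A + x • B).PosSemidef) :
    eigDown (directSum A B) (posSemidef_directSum hA hB).isHermitian (2 * j) hj2 ≤
      eigDown (x • A + (1 - x) • B) hP.isHermitian j hj +
        eigDown ((1 - x) • A + x • B) hQ.isHermitian j hj := by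
  have hM := (posSemidef_directSum hA hB).isHermitian
  set c := √x
  set s := √(1 - x)
  have hc : c ^ 2 = x := Real.sq_sqrt hx0
  have hs : s ^ 2 = 1 - x := Real.sq_sqrt (by linarith)
  -- `pu` and `pw` are the two components of a vector after the inverse rotation.
  let pu : (Fin n ⊕ Fin n → ℂ) →ₗ[ℂ] (Fin n → ℂ) :=
    (c : ℂ) • LinearMap.funLeft ℂ ℂ Sum.inl + (s : ℂ) • LinearMap.funLeft ℂ ℂ Sum.inr
  let pw : (Fin n ⊕ Fin n → ℂ) →ₗ[ℂ] (Fin n → ℂ) :=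
    (-s : ℂ) • LinearMap.funLeft ℂ ℂ Sum.inl + (c : ℂ) • LinearMap.funLeft ℂ ℂ Sum.inr
  obtain ⟨z, hz, h⟩ := exists_reQuad_one_eq_one
    (ι := {i : Fin (Fintype.card (Fin n ⊕ Fin n)) // 2 * j < (i : ℕ)} ⊕
      ({i : Fin (Fintype.card (Fin n)) // (i : ℕ) < j} ⊕
        {i : Fin (Fintype.card (Fin n)) // (i : ℕ) < j}))
    (Sum.elim (fun i => eigCoord hM i) (Sum.elim (fun i => eigCoord hP.isHermitian i ∘ₗ pu)
      (fun i => eigCoord hQ.isHermitian i ∘ₗ pw)))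
    (by
      -- The conditions number `(2n - 1 - 2j) + j + j = 2n - 1`, one below the dimension; this is
      -- where the index `2j` comes from.
      have hcard := Fintype.card_sum (α := Fin n) (β := Fin n)
      rw [Fintype.card_sum, Fin.card_subtype_lt_val hj2,
        Fintype.card_sum (α := {i : Fin (Fintype.card (Fin n)) // (i : ℕ) < j}),
        Fin.card_subtype_val_lt hj]
      omega)
  have hpu : pu z = c • (z ∘ Sum.inl) + s • (z ∘ Sum.inr) := by
    ext i; simp [pu, LinearMap.funLeft_apply]
  have hpw : pw z = -s • (z ∘ Sum.inl) + c • (z ∘ Sum.inr) := by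
    ext i; simp [pw, LinearMap.funLeft_apply]
  have hcs : (c : ℂ) ^ 2 + (s : ℂ) ^ 2 = 1 := by
    rw [← Complex.ofReal_pow, ← Complex.ofReal_pow, hc, hs]; simp
  have hzelim : z = Sum.elim (c • pu z + -s • pw z) (s • pu z + c • pw z) := by
    rw [hpu, hpw]
    ext (i | i)
    · simp
      linear_combination (-z (Sum.inl i)) * hcs
    · simp
      linear_combination (-z (Sum.inr i)) * hcs
  have hnorm : reQuad 1 (pu z) + reQuad 1 (pw z) = 1 := by
    rw [hpu, hpw, reQuad_one_smul_add_smul, ← reQuad_one_sum, hz, hc, hs]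
    ring
  have htop := eigDown_mul_le_reQuad hM hj2 (v := z) fun i hi => h (Sum.inl ⟨i, hi⟩)
  have hu := reQuad_le_eigDown_mul hP.isHermitian hj (v := pu z)
    fun i hi => h (Sum.inr (Sum.inl ⟨i, hi⟩))
  have hw := reQuad_le_eigDown_mul hQ.isHermitian hj (v := pw z)
    fun i hi => h (Sum.inr (Sum.inr ⟨i, hi⟩))
  rw [hz, mul_one] at htop
  -- The eigenvalues of `P` and `Q` may vanish; adding `ε / 2` to each makes the weights `a`, `b`
  -- positive, so that `a * b` can be cancelled at the end.
  refine htop.trans (le_of_forall_pos_le_add fun ε hε => ?_)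
  set a := eigDown _ hP.isHermitian j hj + ε / 2 with ha
  set b := eigDown _ hQ.isHermitian j hj + ε / 2 with hb
  have hP0 : 0 ≤ eigDown _ hP.isHermitian j hj := eigenvalues₀_nonneg hP ⟨j, hj⟩
  have hQ0 : 0 ≤ eigDown _ hQ.isHermitian j hj := eigenvalues₀_nonneg hQ ⟨j, hj⟩
  have ha0 : 0 < a := by linarith
  have hb0 : 0 < b := by linarith
  have hu0 : 0 ≤ reQuad 1 (pu z) := reQuad_nonneg PosSemidef.one _
  have hw0 : 0 ≤ reQuad 1 (pw z) := reQuad_nonneg PosSemidef.one _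
  have key := mul_reQuad_directSum_le hA hB c s a b (pu z) (pw z)
  rw [← hzelim, hc, hs] at key
  have hu' : reQuad (x • A + (1 - x) • B) (pu z) ≤ a * reQuad 1 (pu z) :=
    hu.trans (mul_le_mul_of_nonneg_right (by linarith) hu0)
  have hw' : reQuad ((1 - x) • A + x • B) (pw z) ≤ b * reQuad 1 (pw z) :=
    hw.trans (mul_le_mul_of_nonneg_right (by linarith) hw0)
  have hbound : b * reQuad (x • A + (1 - x) • B) (pu z) + a * reQuad ((1 - x) • A + x • B) (pw z) ≤
      a * b :=
    calc _ ≤ b * (a * reQuad 1 (pu z)) + a * (b * reQuad 1 (pw z)) := by gcongr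
      _ = a * b * (reQuad 1 (pu z) + reQuad 1 (pw z)) := by ring
      _ = a * b := by rw [hnorm, mul_one]
  have hfin : a * b * reQuad (directSum A B) z ≤ a * b * (a + b) := by
    refine key.trans ?_
    rw [mul_comm (a * b)]
    exact mul_le_mul_of_nonneg_left hbound (by linarith)
  have := le_of_mul_le_mul_left hfin (mul_pos ha0 hb0)
  linarith

end DirectSum

theorem corollary2p2 (n : ℕ) (A B : Matrix (Fin n) (Fin n) ℂ)
    (hA : A.PosSemidef) (hB : B.PosSemidef) (x : ℝ) (hx0 : 0 < x) (hx1 : x < 1)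
    (f : ℝ → ℝ) (hf : ConcaveOn ℝ (Set.Ici 0) f) (hf0 : ∀ t : ℝ, 0 ≤ t → 0 ≤ f t)
    (j : ℕ) (hj : j < n) :
    eigDown (matFun f (directSum A B)) (matFun_isHermitian f _) (2 * j)
        (by simp only [Fintype.card_sum, Fintype.card_fin]; omega) ≤
      eigDown (matFun f (x • A + (1 - x) • B)) (matFun_isHermitian f _) j
          (hj.trans_eq (Fintype.card_fin n).symm) +
        eigDown (matFun f ((1 - x) • A + x • B)) (matFun_isHermitian f _) j
          (hj.trans_eq (Fintype.card_fin n).symm) ∧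
    eigDown (matFun f (x • A + (1 - x) • B) + matFun f ((1 - x) • A + x • B))
        ((matFun_isHermitian f _).add (matFun_isHermitian f _)) j
        (hj.trans_eq (Fintype.card_fin n).symm) ≤
      2 * eigDown (matFun f ((1 / 2 : ℝ) • (A + B))) (matFun_isHermitian f _) j
        (hj.trans_eq (Fintype.card_fin n).symm) := by
  have hmono := hf.monotoneOn_Ici_of_nonneg hf0
  have hP : (x • A + (1 - x) • B).PosSemidef :=
    (hA.smul hx0.le).add (hB.smul (sub_nonneg.2 hx1.le))
  have hQ : ((1 - x) • A + x • B).PosSemidef :=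
    (hA.smul (sub_nonneg.2 hx1.le)).add (hB.smul hx0.le)
  constructor
  · have hM := posSemidef_directSum hA hB
    rw [eigDown_matFun hM hmono, eigDown_matFun hP hmono, eigDown_matFun hQ hmono]
    have hP0 := eigenvalues₀_nonneg hP ⟨j, hj.trans_eq (Fintype.card_fin n).symm⟩
    have hQ0 := eigenvalues₀_nonneg hQ ⟨j, hj.trans_eq (Fintype.card_fin n).symm⟩
    refine (hmono ?_ ?_ (eigDown_directSum_le hA hB hx0.le hx1.le _ _ hP hQ)).trans
      (hf.map_add_le_of_nonneg hf0 hP0 hQ0)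
    · exact eigenvalues₀_nonneg hM _
    · exact add_nonneg hP0 hQ0
  · have h := eigDown_matFun_add_matFun_le hP hQ hf hmono
      (hj.trans_eq (Fintype.card_fin n).symm)
    have hsum : x • A + (1 - x) • B + ((1 - x) • A + x • B) = A + B := by module
    simpa only [hsum] using h
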